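/- Let $k$ be a field and let $Q$ be a finite quiver. Let $kQ$ be its path algebra, with product $\beta\alpha$ of paths the concatenation "first $\alpha$, then $\beta$" if $t(\alpha)=s(\beta)$, and $0$ otherwise. Let $I$ be a two-sided ideal of $kQ$ which is admissible, that is $\langle Q_n\rangle\subseteq I\subseteq\langle Q_2\rangle$ for some $n\ge 2$, where $Q_m$ is the set of paths of length $m$. Let $B=kQ/I$ be the corresponding bound quiver algebra. Let $F$ be a finite set of new arrows, that is a finite set with two maps $s,t:F\to Q_0$. Let $Q_F$ be the quiver with vertices $Q_0$ and arrows $Q_1\sqcup F$, and let $B_F=kQ_F/\langle I\rangle_{kQ_F}$, where $\langle I\rangle_{kQ_F}$ is the two-sided ideal of $kQ_F$ generated by $I$. Suppose that there are no relative cycles. That is, there is no sequence $(a_n,\dots,a_1)$ of new arrows, $n\geq 1$, such that $s(a_{i+1})\,B\,t(a_i)\neq 0$ for $i=1,\dots,n-1$ and $s(a_1)\,B\,t(a_n)\neq 0$, where vertices are identified with the corresponding idempotents of $B$. Then the $k$-linear map $$\mathsf{HH}_1(B)\longrightarrow \mathsf{HH}_1(B_F)$$ induced on first Hochschild homology by the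 canonical algebra morphism $B\to B_F$ is an isomorphism. Here $\mathsf{HH}_1(A)$, for a $k$-algebra $A$, is the kernel of $A\otimes_k A\to A$, $a\otimes b\mapsto ab-ba$, modulo the image of $A\otimes_k A\otimes_k A\to A\otimes_k A$, $a\otimes b\otimes c\mapsto ab\otimes c-a\otimes bc+ca\otimes b$. -/

import Mathlib

open scoped TensorProduct

noncomputable section

/-! ### The path algebra of a quiver with finitely many vertices -/

/-- The set `Q_*` of all paths of a quiver: a path together with its source and its target. -/
structure QPath (V : Type*) [Quiver V] where
  /-- The source of the path. -/
  src : V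
  /-- The target of the path. -/
  tgt : V
  /-- The underlying path from `src` to `tgt`. -/
  path : Quiver.Path src tgt

namespace QPath

variable {V : Type*} [Quiver V]

/-- The trivial path (of length `0`) at a vertex. -/
def triv (v : V) : QPath V := ⟨v, v, Quiver.Path.nil⟩

/-- The length of a path. -/
def length (p : QPath V) : ℕ := p.path.length

/-- The concatenation `β α` ("first `α`, then `β`") of two paths with `t(α) = s(β)`. -/
def concat (β α : QPath V) (h : α.tgt = β.src) : QPath V :=
  ⟨α.src, β.tgt, α.path.comp (β.path.cast h.symm rfl)⟩

theorem concat_triv (α : QPath V) (v : V) (h : v = α.src) :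
    concat α (triv v) h = α := by
  subst h
  simp [concat, triv]

theorem triv_concat (α : QPath V) (v : V) (h : α.tgt = v) :
    concat (triv v) α h = α := by
  subst h
  simp [concat, triv]

theorem concat_assoc (γ β α : QPath V) (h : α.tgt = β.src) (h' : β.tgt = γ.src) :
    concat (concat γ β h') α h = concat γ (concat β α h) h' := by
  obtain ⟨a, b, p⟩ := α
  obtain ⟨b', c, q⟩ := β
  obtain ⟨c', d, r⟩ := γ
  dsimp at h h'
  subst h h'
  simp [concat]

end QPath

/-- The path algebra `kQ`: the `k`-vector space with basis the set of all paths. -/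
def PathAlgebra (k : Type*) (V : Type*) [Semiring k] [Quiver V] := QPath V →₀ k

namespace PathAlgebra

variable {k : Type*} [CommRing k] {V : Type*} [Quiver V]

instance : AddCommGroup (PathAlgebra k V) := inferInstanceAs (AddCommGroup (QPath V →₀ k))
instance : Module k (PathAlgebra k V) := inferInstanceAs (Module k (QPath V →₀ k))

/-- The basis element of the path algebra given by a path. -/
def of (p : QPath V) : PathAlgebra k V := Finsupp.single p (1 : k)

/-- The paths form a basis of the path algebra. -/
def basis (k V : Type*) [CommRing k] [Quiver V] : Module.Basis (QPath V) k (PathAlgebra k V) :=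
  ⟨LinearEquiv.refl k (QPath V →₀ k)⟩

@[simp] theorem basis_apply (p : QPath V) : basis k V p = of p := rfl

open Classical in
/-- The product of two paths: the concatenation `β α` if `t(α) = s(β)`, and `0` otherwise. -/
def pathMul (β α : QPath V) : PathAlgebra k V :=
  if h : α.tgt = β.src then of (QPath.concat β α h) else 0

/-- The bilinear extension of the product of paths. -/
def mulₗ : PathAlgebra k V →ₗ[k] PathAlgebra k V →ₗ[k] PathAlgebra k V :=
  (basis k V).constr k fun β => (basis k V).constr k fun α => pathMul β α

instance : Mul (PathAlgebra k V) := ⟨fun x y => mulₗ x y⟩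

theorem mul_def (x y : PathAlgebra k V) : x * y = mulₗ x y := rfl

theorem of_mul_of (β α : QPath V) : (of β * of α : PathAlgebra k V) = pathMul β α := by
  rw [mul_def, mulₗ, ← basis_apply, ← basis_apply, Module.Basis.constr_basis,
    Module.Basis.constr_basis]

theorem of_mul_of_eq (β α : QPath V) (h : α.tgt = β.src) :
    (of β * of α : PathAlgebra k V) = of (QPath.concat β α h) := by
  rw [of_mul_of, pathMul, dif_pos h]

theorem of_mul_of_ne (β α : QPath V) (h : α.tgt ≠ β.src) :
    (of β * of α : PathAlgebra k V) = 0 := by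
  rw [of_mul_of, pathMul, dif_neg h]

@[elab_as_elim]
theorem induction {motive : PathAlgebra k V → Prop} (x : PathAlgebra k V)
    (zero : motive 0) (add : ∀ x y, motive x → motive y → motive (x + y))
    (smul_of : ∀ (c : k) (p : QPath V), motive (c • of p)) : motive x := by
  refine Finsupp.induction_linear x zero (fun x y => add x y) fun p c => ?_
  have h : (Finsupp.single p c : QPath V →₀ k) = c • Finsupp.single p (1 : k) := by simp
  rw [h]
  exact smul_of c p

instance : NonUnitalNonAssocRing (PathAlgebra k V) :=
  { (inferInstance : AddCommGroup (PathAlgebra k V)),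
    (inferInstance : Mul (PathAlgebra k V)) with
    left_distrib := fun x y z => map_add (mulₗ x) y z
    right_distrib := fun x y z => by simp [mul_def]
    zero_mul := fun x => by simp [mul_def]
    mul_zero := fun x => by simp [mul_def] }

theorem smul_mul (c : k) (x y : PathAlgebra k V) : (c • x) * y = c • (x * y) := by
  simp [mul_def]

theorem mul_smul (c : k) (x y : PathAlgebra k V) : x * (c • y) = c • (x * y) := by
  simp [mul_def]

theorem mul_assoc_aux (x y z : PathAlgebra k V) : x * y * z = x * (y * z) := by
  induction x using induction with
  | zero => simp
  | add x x' hx hx' => simp only [add_mul, hx, hx']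
  | smul_of c γ =>
    simp only [smul_mul]
    congr 1
    induction y using induction with
    | zero => simp
    | add x x' hx hx' => simp only [add_mul, mul_add, hx, hx']
    | smul_of c β =>
      simp only [smul_mul, mul_smul]
      congr 1
      induction z using induction with
      | zero => simp
      | add x x' hx hx' => simp only [mul_add, hx, hx']
      | smul_of c α =>
        simp only [mul_smul]
        congr 1
        by_cases h : α.tgt = β.src
        · by_cases h' : β.tgt = γ.src
          · rw [of_mul_of_eq γ β h', of_mul_of_eq β α h, of_mul_of_eq (QPath.concat γ β h') α h,
              of_mul_of_eq γ (QPath.concat β α h) h', QPath.concat_assoc]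
          · rw [of_mul_of_ne γ β h', of_mul_of_eq β α h,
              of_mul_of_ne γ (QPath.concat β α h) h', zero_mul]
        · by_cases h' : β.tgt = γ.src
          · rw [of_mul_of_eq γ β h', of_mul_of_ne β α h,
              of_mul_of_ne (QPath.concat γ β h') α h, mul_zero]
          · rw [of_mul_of_ne γ β h', of_mul_of_ne β α h, zero_mul, mul_zero]

variable [Fintype V]

/-- The unit of the path algebra is the sum of the vertices (trivial paths). -/
instance : One (PathAlgebra k V) := ⟨∑ v : V, of (QPath.triv v)⟩

theorem one_def : (1 : PathAlgebra k V) = ∑ v : V, of (QPath.triv v) := rfl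

theorem one_mul_aux (x : PathAlgebra k V) : 1 * x = x := by
  induction x using induction with
  | zero => simp
  | add x x' hx hx' => simp only [mul_add, hx, hx']
  | smul_of c α =>
    rw [mul_smul, one_def, Finset.sum_mul, Finset.sum_eq_single α.tgt]
    · have h : α.tgt = (QPath.triv α.tgt).src := rfl
      rw [of_mul_of_eq (QPath.triv α.tgt) α h]
      exact congrArg (fun p => c • of p) (QPath.triv_concat α α.tgt rfl)
    · exact fun v _ hv => of_mul_of_ne _ _ (Ne.symm hv)
    · simp

theorem mul_one_aux (x : PathAlgebra k V) : x * 1 = x := by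
  induction x using induction with
  | zero => simp
  | add x x' hx hx' => simp only [add_mul, hx, hx']
  | smul_of c α =>
    rw [smul_mul, one_def, Finset.mul_sum, Finset.sum_eq_single α.src]
    · have h : (QPath.triv α.src).tgt = α.src := rfl
      rw [of_mul_of_eq α (QPath.triv α.src) h]
      exact congrArg (fun p => c • of p) (QPath.concat_triv α α.src rfl)
    · exact fun v _ hv => of_mul_of_ne _ _ hv
    · simp

instance : Ring (PathAlgebra k V) :=
  { (inferInstance : NonUnitalNonAssocRing (PathAlgebra k V)),
    (inferInstance : One (PathAlgebra k V)) with
    mul_assoc := mul_assoc_aux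
    one_mul := one_mul_aux
    mul_one := mul_one_aux }

instance : Algebra k (PathAlgebra k V) := Algebra.ofModule smul_mul (fun c x y => mul_smul c x y)

/-- The two-sided ideal `⟨Q_n⟩` generated by the paths of length `n`. -/
def pathIdeal (k V : Type*) [CommRing k] [Quiver V] [Fintype V] (n : ℕ) :
    TwoSidedIdeal (PathAlgebra k V) :=
  TwoSidedIdeal.span {x | ∃ p : QPath V, p.length = n ∧ x = of p}

/-- A two-sided ideal `I` of `kQ` is admissible if `⟨Q_n⟩ ⊆ I ⊆ ⟨Q_2⟩` for some `n ≥ 2`. -/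
def IsAdmissible (I : TwoSidedIdeal (PathAlgebra k V)) : Prop :=
  ∃ n : ℕ, 2 ≤ n ∧ pathIdeal k V n ≤ I ∧ I ≤ pathIdeal k V 2

end PathAlgebra

/-- The algebra `kQ/I`. -/
abbrev QuiverAlgebra {k V : Type*} [CommRing k] [Quiver V] [Fintype V]
    (I : TwoSidedIdeal (PathAlgebra k V)) : Type _ :=
  PathAlgebra k V ⧸ I.asIdeal

/-- The idempotent of `kQ/I` given by a vertex. -/
def QuiverAlgebra.vertex {k V : Type*} [CommRing k] [Quiver V] [Fintype V]
    (I : TwoSidedIdeal (PathAlgebra k V)) (x : V) : QuiverAlgebra I :=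
  Ideal.Quotient.mk I.asIdeal (PathAlgebra.of (QPath.triv x))

/-- The subspace `y B x` of `B = kQ/I`, for vertices `y` and `x`. -/
def QuiverAlgebra.corner {k V : Type*} [CommRing k] [Quiver V] [Fintype V]
    (I : TwoSidedIdeal (PathAlgebra k V)) (y x : V) : Submodule k (QuiverAlgebra I) :=
  LinearMap.range
    (LinearMap.mulLeftRight k (QuiverAlgebra.vertex I y, QuiverAlgebra.vertex I x))

/-! ### Adding new arrows -/

/-- The vertices of the quiver `Q_F`, which are those of `Q`; here `F` is the set of new arrows,
with source and target maps `s` and `t`. -/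
def AddArrows {V F : Type*} (_s _t : F → V) : Type _ := V

namespace AddArrows

variable {k : Type*} [CommRing k] {V F : Type*} [Quiver V] (s t : F → V)

instance [Fintype V] : Fintype (AddArrows s t) := inferInstanceAs (Fintype V)

/-- The arrows of `Q_F` from `x` to `y` are the arrows of `Q` from `x` to `y` together with the
new arrows whose source is `x` and whose target is `y`. -/
instance : Quiver (AddArrows s t) where
  Hom x y := (Quiver.Hom (V := V) x y) ⊕ {a : F // s a = x ∧ t a = y}

/-- The inclusion of `Q` in `Q_F`. -/
def incl : V ⥤q AddArrows s t where
  obj x := x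
  map a := Sum.inl a

/-- A path of `Q`, seen as a path of `Q_F`. -/
def inclPath (p : QPath V) : QPath (AddArrows s t) :=
  ⟨(incl s t).obj p.src, (incl s t).obj p.tgt, (incl s t).mapPath p.path⟩

theorem inclPath_concat (β α : QPath V) (h : α.tgt = β.src) :
    inclPath s t (QPath.concat β α h) = QPath.concat (inclPath s t β) (inclPath s t α) h := by
  obtain ⟨a, b, p⟩ := α
  obtain ⟨b', c, q⟩ := β
  dsimp at h
  subst h
  simp [QPath.concat, inclPath]

/-- The linear extension `kQ → kQ_F` of the inclusion of paths. -/
def inclₗ : PathAlgebra k V →ₗ[k] PathAlgebra k (AddArrows s t) :=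
  (PathAlgebra.basis k V).constr k fun p => PathAlgebra.of (inclPath s t p)

theorem inclₗ_of (p : QPath V) :
    inclₗ (k := k) s t (PathAlgebra.of p) = PathAlgebra.of (inclPath s t p) := by
  rw [inclₗ, ← PathAlgebra.basis_apply, Module.Basis.constr_basis]

variable [Fintype V]

/-- The inclusion of algebras `kQ → kQ_F`. -/
def inclAlg : PathAlgebra k V →ₐ[k] PathAlgebra k (AddArrows s t) :=
  AlgHom.ofLinearMap (inclₗ s t)
    (by
      rw [PathAlgebra.one_def, map_sum]
      simp only [inclₗ_of]
      rfl)
    (by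
      intro x y
      induction x using PathAlgebra.induction with
      | zero => simp
      | add x x' hx hx' => simp only [add_mul, map_add, hx, hx']
      | smul_of c β =>
        simp only [smul_mul_assoc, map_smul]
        congr 1
        induction y using PathAlgebra.induction with
        | zero => simp
        | add x x' hx hx' => simp only [mul_add, map_add, hx, hx']
        | smul_of c α =>
          simp only [mul_smul_comm, map_smul]
          congr 1
          by_cases h : α.tgt = β.src
          · rw [PathAlgebra.of_mul_of_eq β α h, inclₗ_of, inclₗ_of, inclₗ_of, inclPath_concat,
              PathAlgebra.of_mul_of_eq (inclPath s t β) (inclPath s t α) h]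
          · rw [PathAlgebra.of_mul_of_ne β α h, inclₗ_of, inclₗ_of, map_zero,
              PathAlgebra.of_mul_of_ne (inclPath s t β) (inclPath s t α) h])

@[simp] theorem inclAlg_of (p : QPath V) :
    inclAlg (k := k) s t (PathAlgebra.of p) = PathAlgebra.of (inclPath s t p) :=
  inclₗ_of s t p

/-- The two-sided ideal `⟨I⟩_{kQ_F}` of `kQ_F` generated by (the image of) `I`. -/
def extend (I : TwoSidedIdeal (PathAlgebra k V)) :
    TwoSidedIdeal (PathAlgebra k (AddArrows s t)) :=
  TwoSidedIdeal.span (inclAlg s t '' (I : Set (PathAlgebra k V)))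

/-- The canonical algebra morphism `B = kQ/I → B_F = kQ_F/⟨I⟩` induced by the inclusion of
`kQ` in `kQ_F`. -/
def algHom (I : TwoSidedIdeal (PathAlgebra k V)) :
    QuiverAlgebra I →ₐ[k] QuiverAlgebra (extend s t I) :=
  Ideal.quotientMapₐ _ (inclAlg s t) fun _ hx =>
    TwoSidedIdeal.subset_span (Set.mem_image_of_mem _ hx)

/-- A relative path is a nonempty sequence `γ = (a_n, …, a_1)` of new arrows (written as the list
`[a_n, …, a_1]`) such that `s(a_{i+1}) B t(a_i) ≠ 0` for `1 ≤ i ≤ n - 1`. -/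
structure IsRelativePath (I : TwoSidedIdeal (PathAlgebra k V)) (γ : List F) : Prop where
  ne_nil : γ ≠ []
  chain : γ.IsChain fun a' a => QuiverAlgebra.corner I (s a') (t a) ≠ ⊥

/-- A relative cycle is a relative path `γ = (a_n, …, a_1)` such that `s(γ) B t(γ) ≠ 0`, where
`s(γ) = s(a_1)` and `t(γ) = t(a_n)`. -/
def IsRelativeCycle (I : TwoSidedIdeal (PathAlgebra k V)) (γ : List F) : Prop :=
  ∃ h : IsRelativePath s t I γ,
    QuiverAlgebra.corner I (s (γ.getLast h.ne_nil)) (t (γ.head h.ne_nil)) ≠ ⊥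

end AddArrows

/-! ### First Hochschild homology -/

namespace Hochschild

variable (k : Type*) [CommRing k] (A : Type*) [Ring A] [Algebra k A]

/-- The Hochschild boundary `A ⊗ A → A`, `a₀ ⊗ a₁ ↦ a₀ a₁ - a₁ a₀`. -/
def d₁ : A ⊗[k] A →ₗ[k] A :=
  LinearMap.mul' k A - LinearMap.mul' k A ∘ₗ (TensorProduct.comm k A A).toLinearMap

/-- The map `a₀ ⊗ a₁ ⊗ a₂ ↦ a₀ a₁ ⊗ a₂`. -/
def mulFirst : A ⊗[k] (A ⊗[k] A) →ₗ[k] A ⊗[k] A :=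
  LinearMap.rTensor A (LinearMap.mul' k A) ∘ₗ (TensorProduct.assoc k A A A).symm.toLinearMap

/-- The cyclic permutation `a₀ ⊗ a₁ ⊗ a₂ ↦ a₂ ⊗ a₀ ⊗ a₁`. -/
def cyc : A ⊗[k] (A ⊗[k] A) →ₗ[k] A ⊗[k] (A ⊗[k] A) :=
  (TensorProduct.comm k (A ⊗[k] A) A).toLinearMap ∘ₗ
    (TensorProduct.assoc k A A A).symm.toLinearMap

/-- The Hochschild boundary `A ⊗ A ⊗ A → A ⊗ A`,
`a₀ ⊗ a₁ ⊗ a₂ ↦ a₀ a₁ ⊗ a₂ - a₀ ⊗ a₁ a₂ + a₂ a₀ ⊗ a₁`. -/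
def d₂ : A ⊗[k] (A ⊗[k] A) →ₗ[k] A ⊗[k] A :=
  mulFirst k A - LinearMap.lTensor A (LinearMap.mul' k A) + mulFirst k A ∘ₗ cyc k A

variable {A}

@[simp] theorem d₁_tmul (a b : A) : d₁ k A (a ⊗ₜ b) = a * b - b * a := by
  simp [d₁]

@[simp] theorem d₂_tmul (a b c : A) :
    d₂ k A (a ⊗ₜ (b ⊗ₜ c)) = (a * b) ⊗ₜ c - a ⊗ₜ (b * c) + (c * a) ⊗ₜ b := by
  simp [d₂, mulFirst, cyc]

variable (A)

theorem d₁_comp_d₂ : d₁ k A ∘ₗ d₂ k A = 0 := by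
  ext a b c
  simp [mul_assoc]

/-- The first Hochschild homology `HH_1(A) = Ker d₁ / Im d₂` of a `k`-algebra `A`. -/
abbrev HH₁ : Type _ :=
  LinearMap.ker (d₁ k A) ⧸ (LinearMap.range (d₂ k A)).submoduleOf (LinearMap.ker (d₁ k A))

variable {k A} {A' : Type*} [Ring A'] [Algebra k A']

theorem d₁_map (f : A →ₐ[k] A') (x : A ⊗[k] A) :
    d₁ k A' (TensorProduct.map f.toLinearMap f.toLinearMap x) = f (d₁ k A x) := by
  induction x with
  | zero => simp
  | tmul a b => simp
  | add x y hx hy => simp only [map_add, hx, hy]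

theorem d₂_map (f : A →ₐ[k] A') (x : A ⊗[k] (A ⊗[k] A)) :
    d₂ k A' (TensorProduct.map f.toLinearMap (TensorProduct.map f.toLinearMap f.toLinearMap) x) =
      TensorProduct.map f.toLinearMap f.toLinearMap (d₂ k A x) := by
  induction x with
  | zero => simp
  | tmul a y =>
    induction y with
    | zero => simp
    | tmul b c => simp
    | add x y hx hy => simp only [TensorProduct.tmul_add, map_add, hx, hy]
  | add x y hx hy => simp only [map_add, hx, hy]

/-- The map induced by an algebra morphism on `1`-cycles. -/
def cyclesMap (f : A →ₐ[k] A') : LinearMap.ker (d₁ k A) →ₗ[k] LinearMap.ker (d₁ k A') :=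
  (TensorProduct.map f.toLinearMap f.toLinearMap).restrict fun x hx => by
    rw [LinearMap.mem_ker] at hx ⊢
    rw [d₁_map, hx, map_zero]

/-- The map `HH_1(A) → HH_1(A')` induced by an algebra morphism `f : A → A'`, namely
`a₀ ⊗ a₁ ↦ f(a₀) ⊗ f(a₁)` on cycles. -/
def HH₁.map (f : A →ₐ[k] A') : HH₁ k A →ₗ[k] HH₁ k A' :=
  Submodule.mapQ _ _ (cyclesMap f) fun x hx => by
    obtain ⟨y, hy⟩ := hx
    exact ⟨TensorProduct.map f.toLinearMap (TensorProduct.map f.toLinearMap f.toLinearMap) y, by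
      rw [d₂_map, hy]; rfl⟩

end Hochschild

end

/-!
The morphism `ι : B → B_F` has a retraction `π`, which sends the new arrows to zero, so `HH₁(ι)` is
injective. For surjectivity, a `1`-cycle of `B_F` has to be moved into `B ⊗ B` by boundaries.

* Modulo boundaries, `B_F ⊗ B_F` reduces to `B_F ⊗ B` (`AddArrows.mem_range_d₂_sup`). Cutting the
  second factor into arrows leaves the terms `c ⊗ f` with `f` a new arrow, and these reduce to
  `e_{s(f)} c e_{t(f)} ⊗ f`. The space `e_{s(f)} B_F e_{t(f)}` is zero
  (`AddArrows.vertex_mul_mul_vertex_eq_zero`), since a path of `Q_F` that is nonzero in it would give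
  a relative cycle together with `f`.
* `B_F = B ⊕ ker π`, and `ker π` is spanned by the products `b f a` with `b ∈ B`, `f` a new arrow
  and `a ∈ B_F`. There is a linear map `h` with `h(b f a) = f a ⊗ b e_{t(f)}`
  (`AddArrows.exists_homotopy`). For `b ∈ B e_{t(f)}` and `c ∈ B`,
  `d₂(f a ⊗ c ⊗ b) = b f a ⊗ c + h(d₁(b f a ⊗ c))`, so a cycle in `ker π ⊗ B` is a boundary
  (`Hochschild.tmul_add_homotopy_mem_range_d₂`). This is the vanishing of the homology of `B` with
  coefficients in `ker π`, which is a direct sum of bimodules `B e ⊗ M` induced on the left.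
* For a cycle in `B_F ⊗ B`, the components in `B ⊗ B` and in `ker π ⊗ B` are both cycles, since
  their boundaries lie in `B` and in `ker π`; the second one is a boundary.

The map `h` is well defined because it is a derivation into a bimodule, hence is encoded by an
algebra morphism from `B_F` to the endomorphisms of `B_F × (B_F ⊗ B_F)`, and these morphisms are
given by the universal property of the path algebra (`PathFamily.lift`, `AddArrows.exists_lift`).
-/

noncomputable section

/-! ### A criterion for the map on first Hochschild homology to be bijective -/

namespace Hochschild

section Criterion

variable {k : Type*} [CommRing k] {A B : Type*} [Ring A] [Algebra k A] [Ring B] [Algebra k B]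

/-- A morphism with a left inverse is injective on first Hochschild homology, by functoriality. -/
theorem HH₁.map_injective_of_leftInverse (ι : B →ₐ[k] A) (π : A →ₐ[k] B)
    (hπ : π.comp ι = AlgHom.id k B) : Function.Injective (HH₁.map ι) := by
  have key : ∀ x, HH₁.map π (HH₁.map ι x) = x := by
    intro x
    obtain ⟨x, rfl⟩ := Submodule.Quotient.mk_surjective _ x
    simp only [HH₁.map, Submodule.mapQ_apply]
    congr 1
    apply Subtype.ext
    change TensorProduct.map π.toLinearMap π.toLinearMap
      (TensorProduct.map ι.toLinearMap ι.toLinearMap x.1) = x.1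
    have h : π.toLinearMap ∘ₗ ι.toLinearMap = LinearMap.id := by
      rw [← AlgHom.comp_toLinearMap, hπ]; rfl
    rw [← LinearMap.comp_apply, ← TensorProduct.map_comp, h, TensorProduct.map_id]
    rfl
  exact Function.LeftInverse.injective key

/-- A linear map `h` with `h(ι(b) w) = w ⊗ ι(b)` on a suitable spanning set of `ker π` is a
homotopy showing that `ker π ⊗ B` contributes no homology: modulo `Im d₂`, every element `y` of
`ker π ⊗ B` equals `-h (d₁ y)`. -/
theorem tmul_add_homotopy_mem_range_d₂ (ι : B →ₐ[k] A) (N : Set (B × A)) (h : A →ₗ[k] A ⊗[k] A)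
    (hl : ∀ p ∈ N, ∀ c, h (ι c * (ι p.1 * p.2)) = p.2 ⊗ₜ ι (c * p.1))
    (hr : ∀ p ∈ N, ∀ c, h (ι p.1 * p.2 * ι c) = (p.2 * ι c) ⊗ₜ ι p.1)
    {a : A} (ha : a ∈ Submodule.span k ((fun p : B × A => ι p.1 * p.2) '' N)) (c : B) :
    a ⊗ₜ ι c + h (d₁ k A (a ⊗ₜ ι c)) ∈ LinearMap.range (d₂ k A) := by
  induction ha using Submodule.span_induction with
  | mem x hx =>
    obtain ⟨p, hp, rfl⟩ := hx
    refine ⟨p.2 ⊗ₜ (ι c ⊗ₜ ι p.1), ?_⟩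
    simp only [d₂_tmul, d₁_tmul, map_sub, hl p hp, hr p hp, map_mul]
    abel
  | zero => simp
  | add x y _ _ hx hy =>
    convert add_mem hx hy using 1
    simp only [TensorProduct.add_tmul, map_add]
    abel
  | smul r x _ hx =>
    convert Submodule.smul_mem _ r hx using 1
    simp only [← TensorProduct.smul_tmul', map_smul, smul_add]

/-- A split morphism `ι : B → A` is an isomorphism on first Hochschild homology if modulo
boundaries every `1`-chain of `A` lies in `A ⊗ B`, and if the kernel of the retraction `π` has a
homotopy `h` as in `tmul_add_homotopy_mem_range_d₂`. -/
theorem HH₁.map_bijective_of_homotopy (ι : B →ₐ[k] A) (π : A →ₐ[k] B)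
    (hπ : π.comp ι = AlgHom.id k B) (N : Set (B × A)) (h : A →ₗ[k] A ⊗[k] A)
    (hl : ∀ p ∈ N, ∀ c, h (ι c * (ι p.1 * p.2)) = p.2 ⊗ₜ ι (c * p.1))
    (hr : ∀ p ∈ N, ∀ c, h (ι p.1 * p.2 * ι c) = (p.2 * ι c) ⊗ₜ ι p.1)
    (hN : ∀ a : A, a - ι (π a) ∈ Submodule.span k ((fun p : B × A => ι p.1 * p.2) '' N))
    (hspan : ∀ z : A ⊗[k] A, z ∈ LinearMap.range (d₂ k A) ⊔
      LinearMap.range (LinearMap.lTensor A ι.toLinearMap)) :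
    Function.Bijective (HH₁.map ι) := by
  refine ⟨HH₁.map_injective_of_leftInverse ι π hπ, fun z => ?_⟩
  obtain ⟨⟨z, hz⟩, rfl⟩ := Submodule.Quotient.mk_surjective _ z
  have hπ' : ∀ b, π (ι b) = b := fun b => DFunLike.congr_fun hπ b
  obtain ⟨_, ⟨y, rfl⟩, _, ⟨x, rfl⟩, rfl⟩ := Submodule.mem_sup.1 (hspan z)
  rw [LinearMap.mem_ker, map_add, ← LinearMap.comp_apply, d₁_comp_d₂, LinearMap.zero_apply,
    zero_add] at hz
  -- The component of `x` in `B ⊗ B`, for the decomposition `A = B ⊕ ker π`.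
  set x₀ : B ⊗[k] B := LinearMap.rTensor B π.toLinearMap x with hx₀
  have hmap : ∀ x : A ⊗[k] B, TensorProduct.map π.toLinearMap π.toLinearMap
      (LinearMap.lTensor A ι.toLinearMap x) = LinearMap.rTensor B π.toLinearMap x := by
    intro x
    induction x with
    | zero => simp
    | tmul a b => simp [hπ']
    | add u v hu hv => simp only [map_add, hu, hv]
  have hx₀cycle : d₁ k B x₀ = 0 := by
    rw [hx₀, ← hmap, d₁_map, hz, map_zero]
  have hrest : ∀ x : A ⊗[k] B,
      (LinearMap.lTensor A ι.toLinearMap x - TensorProduct.map ι.toLinearMap ι.toLinearMap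
        (LinearMap.rTensor B π.toLinearMap x)) +
      h (d₁ k A (LinearMap.lTensor A ι.toLinearMap x -
        TensorProduct.map ι.toLinearMap ι.toLinearMap (LinearMap.rTensor B π.toLinearMap x)))
      ∈ LinearMap.range (d₂ k A) := by
    intro x
    induction x with
    | zero => simp
    | tmul a b =>
      have := tmul_add_homotopy_mem_range_d₂ ι N h hl hr (hN a) b
      rw [TensorProduct.sub_tmul] at this
      exact this
    | add u v hu hv =>
      convert add_mem hu hv using 1
      simp only [map_add, map_sub]
      abel
  have hx := hrest x
  rw [map_sub (d₁ k A), hz, d₁_map, ← hx₀, hx₀cycle, map_zero, sub_zero, map_zero, add_zero] at hx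
  refine ⟨Submodule.Quotient.mk ⟨x₀, hx₀cycle⟩, ?_⟩
  simp only [HH₁.map, Submodule.mapQ_apply]
  rw [Submodule.Quotient.eq, Submodule.submoduleOf, Submodule.mem_comap]
  change TensorProduct.map ι.toLinearMap ι.toLinearMap x₀ -
    (d₂ k A y + LinearMap.lTensor A ι.toLinearMap x) ∈ LinearMap.range (d₂ k A)
  convert neg_mem (add_mem (LinearMap.mem_range_self (d₂ k A) y) hx) using 1
  abel

/-- The block-diagonal action of `B` on `A × (A ⊗ A)`: left multiplication on `A` and on the second
factor of `A ⊗ A`. -/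
def splitRep (ι : B →ₐ[k] A) : B →ₐ[k] Module.End k (A × (A ⊗[k] A)) :=
  AlgHom.ofLinearMap
    { toFun := fun b => LinearMap.prodMap (LinearMap.mulLeft k (ι b))
        (LinearMap.lTensor A (LinearMap.mulLeft k (ι b)))
      map_add' := fun b c => by
        rw [map_add, show LinearMap.mulLeft k (ι b + ι c) = LinearMap.mulLeft k (ι b) +
          LinearMap.mulLeft k (ι c) from map_add (LinearMap.mul k A) _ _, LinearMap.lTensor_add,
          LinearMap.prodMap_add]
      map_smul' := fun r b => by
        rw [map_smul, show LinearMap.mulLeft k (r • ι b) = r • LinearMap.mulLeft k (ι b) from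
          map_smul (LinearMap.mul k A) _ _, LinearMap.lTensor_smul]
        rfl }
    (by
      change LinearMap.prodMap (LinearMap.mulLeft k (ι 1)) _ = _
      rw [map_one, LinearMap.mulLeft_one, LinearMap.lTensor_id, LinearMap.prodMap_id]
      rfl)
    (fun b c => by
      change LinearMap.prodMap (LinearMap.mulLeft k (ι (b * c))) _ = _
      rw [map_mul, LinearMap.mulLeft_mul, LinearMap.lTensor_comp]
      rfl)

theorem splitRep_apply (ι : B →ₐ[k] A) (b : B) (y : A) (m : A ⊗[k] A) :
    splitRep ι b (y, m) = (ι b * y, LinearMap.lTensor A (LinearMap.mulLeft k (ι b)) m) := rfl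

/-- The endomorphism `(y, m) ↦ (a y, a y ⊗ e)` of `A × (A ⊗ A)`. It is the action of an element
`a` under the morphism `x ↦ ((y, m) ↦ (x y, h(x) y + x m))` that encodes a derivation `h` with
values in `A ⊗ A`, when `h(a) = a ⊗ e` and `a` acts as `0` in the left module structure of `A ⊗ A`;
the right one is `(x ⊗ y) a = x a ⊗ y`. -/
def splitEnd (a e : A) : Module.End k (A × (A ⊗[k] A)) :=
  LinearMap.prod (LinearMap.mulLeft k a)
    ((TensorProduct.mk k A A).flip e ∘ₗ LinearMap.mulLeft k a) ∘ₗ LinearMap.fst k A (A ⊗[k] A)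

theorem splitEnd_apply (a e y : A) (m : A ⊗[k] A) :
    splitEnd (k := k) a e (y, m) = (a * y, (a * y) ⊗ₜ e) := rfl

/-- If `Φ` encodes a derivation of `A` whose values on `ι(B)` vanish and whose values on elements
`g f` are `g f ⊗ e f`, then its derivation, `x ↦ (Φ x (1, 0)).2`, satisfies
`b g a ↦ g a ⊗ b e`. -/
theorem exists_linearMap_of_splitRep {F : Type*} (ι : B →ₐ[k] A)
    (Φ : A →ₐ[k] Module.End k (A × (A ⊗[k] A))) (g e : F → A)
    (hι : ∀ b, Φ (ι b) = splitRep ι b) (hg : ∀ f, Φ (g f) = splitEnd (g f) (e f))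
    (hfst : ∀ x y m, (Φ x (y, m)).1 = x * y) :
    ∃ h : A →ₗ[k] A ⊗[k] A, ∀ b f a, h (ι b * (g f * a)) = (g f * a) ⊗ₜ (ι b * e f) := by
  refine ⟨LinearMap.snd k A (A ⊗[k] A) ∘ₗ LinearMap.applyₗ ((1 : A), (0 : A ⊗[k] A)) ∘ₗ
    Φ.toLinearMap, fun b f a => ?_⟩
  change (Φ (ι b * (g f * a)) (1, 0)).2 = _
  rw [map_mul, map_mul, Module.End.mul_apply, Module.End.mul_apply, hι, hg,
    ← Prod.mk.eta (p := Φ a (1, 0)), splitEnd_apply, splitRep_apply, hfst, mul_one,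
    LinearMap.lTensor_tmul, LinearMap.mulLeft_apply]

/-- The elements of `A` whose image under `Φ` acts on the first component of `A × (A ⊗ A)` by left
multiplication. -/
def fstMulLocus (Φ : A →ₐ[k] Module.End k (A × (A ⊗[k] A))) : Submodule k A where
  carrier := {x | ∀ y m, (Φ x (y, m)).1 = x * y}
  add_mem' hx hx' y m := by
    rw [map_add, LinearMap.add_apply, Prod.fst_add, hx, hx', add_mul]
  zero_mem' y m := by rw [map_zero, LinearMap.zero_apply, Prod.fst_zero, zero_mul]
  smul_mem' c x hx y m := by
    rw [map_smul, LinearMap.smul_apply, Prod.smul_fst, hx, smul_mul_assoc]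

theorem mem_fstMulLocus {Φ : A →ₐ[k] Module.End k (A × (A ⊗[k] A))} {x : A} :
    x ∈ fstMulLocus Φ ↔ ∀ y m, (Φ x (y, m)).1 = x * y := Iff.rfl

theorem mul_mem_fstMulLocus {Φ : A →ₐ[k] Module.End k (A × (A ⊗[k] A))} {x x' : A}
    (hx : x ∈ fstMulLocus Φ) (hx' : x' ∈ fstMulLocus Φ) : x * x' ∈ fstMulLocus Φ := by
  intro y m
  rw [map_mul, Module.End.mul_apply, ← Prod.mk.eta (p := Φ x' (y, m)), hx, hx', mul_assoc]

end Criterion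

end Hochschild

/-! ### The universal property of the path algebra -/

/-- The data of an algebra morphism `kQ → R`: images of the vertices, which form a complete family
of orthogonal idempotents, and compatible images of the arrows. -/
structure PathFamily (V : Type*) [Quiver V] [Fintype V] (R : Type*) [Ring R] where
  /-- The image of a vertex. -/
  vert : V → R
  /-- The image of an arrow. -/
  arr : ∀ {x y : V}, (x ⟶ y) → R
  vert_mul_self : ∀ x, vert x * vert x = vert x
  vert_mul_of_ne : ∀ x y, x ≠ y → vert x * vert y = 0
  sum_vert : ∑ x, vert x = 1
  vert_mul_arr : ∀ {x y : V} (a : x ⟶ y), vert y * arr a = arr a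
  arr_mul_vert : ∀ {x y : V} (a : x ⟶ y), arr a * vert x = arr a

namespace PathFamily

variable {k : Type*} [CommRing k] {V : Type*} [Quiver V] [Fintype V] {R : Type*} [Ring R]
  [Algebra k R] (Φ : PathFamily V R)

/-- The image of a path: the product of the images of its arrows. -/
def ofPath {x : V} : ∀ {y : V}, Quiver.Path x y → R
  | _, .nil => Φ.vert x
  | _, .cons p a => Φ.arr a * ofPath p

theorem ofPath_mul_vert {x y : V} (p : Quiver.Path x y) : Φ.ofPath p * Φ.vert x = Φ.ofPath p := by
  induction p with
  | nil => exact Φ.vert_mul_self x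
  | cons p a ih => rw [ofPath, mul_assoc, ih]

theorem vert_mul_ofPath {x y : V} (p : Quiver.Path x y) : Φ.vert y * Φ.ofPath p = Φ.ofPath p := by
  cases p with
  | nil => exact Φ.vert_mul_self x
  | cons p a => rw [ofPath, ← mul_assoc, Φ.vert_mul_arr]

theorem ofPath_comp {x y z : V} (p : Quiver.Path x y) (q : Quiver.Path y z) :
    Φ.ofPath (p.comp q) = Φ.ofPath q * Φ.ofPath p := by
  induction q with
  | nil => exact (Φ.vert_mul_ofPath p).symm
  | cons q a ih => rw [Quiver.Path.comp_cons, ofPath, ofPath, ih, mul_assoc]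

/-- The linear extension of `PathFamily.ofPath` to the path algebra. -/
def liftₗ : PathAlgebra k V →ₗ[k] R :=
  (PathAlgebra.basis k V).constr k fun p => Φ.ofPath p.path

theorem liftₗ_of (p : QPath V) : Φ.liftₗ (PathAlgebra.of (k := k) p) = Φ.ofPath p.path := by
  rw [liftₗ, ← PathAlgebra.basis_apply, Module.Basis.constr_basis]

/-- The algebra morphism `kQ → R` given by the images of the vertices and arrows. -/
def lift : PathAlgebra k V →ₐ[k] R :=
  AlgHom.ofLinearMap Φ.liftₗ
    (by
      rw [PathAlgebra.one_def, map_sum]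
      simp only [liftₗ_of]
      exact Φ.sum_vert)
    (by
      intro x y
      induction x using PathAlgebra.induction with
      | zero => simp
      | add x x' hx hx' => simp only [add_mul, map_add, hx, hx']
      | smul_of c β =>
        simp only [smul_mul_assoc, map_smul]
        congr 1
        induction y using PathAlgebra.induction with
        | zero => simp
        | add x x' hx hx' => simp only [mul_add, map_add, hx, hx']
        | smul_of c α =>
          simp only [mul_smul_comm, map_smul]
          congr 1
          obtain ⟨a, b, p⟩ := α
          obtain ⟨b', d, q⟩ := β
          by_cases h : b = b'
          · subst h
            rw [PathAlgebra.of_mul_of_eq _ _ rfl, liftₗ_of, liftₗ_of, liftₗ_of]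
            exact Φ.ofPath_comp p q
          · rw [PathAlgebra.of_mul_of_ne _ _ h, map_zero, liftₗ_of, liftₗ_of,
              ← Φ.ofPath_mul_vert q, ← Φ.vert_mul_ofPath p, mul_assoc, ← mul_assoc (Φ.vert b'),
              Φ.vert_mul_of_ne _ _ (Ne.symm h), zero_mul, mul_zero])

@[simp] theorem lift_of (p : QPath V) : Φ.lift (PathAlgebra.of (k := k) p) = Φ.ofPath p.path :=
  Φ.liftₗ_of p

end PathFamily

namespace PathAlgebra

variable {k : Type*} [CommRing k] {V : Type*} [Quiver V]

/-- The element of the path algebra given by an arrow. -/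
def arrow {x y : V} (a : x ⟶ y) : PathAlgebra k V := of ⟨x, y, a.toPath⟩

theorem of_cons {x y z : V} (p : Quiver.Path x y) (a : y ⟶ z) :
    (of ⟨x, z, p.cons a⟩ : PathAlgebra k V) = arrow a * of ⟨x, y, p⟩ := by
  rw [arrow, of_mul_of_eq _ _ rfl]
  rfl

theorem vertex_mul_arrow {x y : V} (a : x ⟶ y) :
    (of (QPath.triv y) * arrow a : PathAlgebra k V) = arrow a := by
  exact (of_mul_of_eq _ _ rfl).trans (congrArg of (QPath.triv_concat _ y rfl))

theorem arrow_mul_vertex {x y : V} (a : x ⟶ y) :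
    (arrow a * of (QPath.triv x) : PathAlgebra k V) = arrow a := by
  exact (of_mul_of_eq _ _ rfl).trans (congrArg of (QPath.concat_triv _ x rfl))

theorem vertex_mul_self (x : V) :
    (of (QPath.triv x) * of (QPath.triv x) : PathAlgebra k V) = of (QPath.triv x) := by
  exact (of_mul_of_eq _ _ rfl).trans (congrArg of (QPath.triv_concat _ x rfl))

theorem vertex_mul_of_ne (x y : V) (h : x ≠ y) :
    (of (QPath.triv x) * of (QPath.triv y) : PathAlgebra k V) = 0 :=
  of_mul_of_ne _ _ (Ne.symm h)

variable [Fintype V]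

theorem vertex_mul_mul_vertex_of_ne (p : QPath V) (x y : V) (h : ¬ (p.tgt = y ∧ p.src = x)) :
    (of (QPath.triv y) * of p * of (QPath.triv x) : PathAlgebra k V) = 0 := by
  by_cases h1 : p.tgt = y
  · rw [mul_assoc, of_mul_of_ne p (QPath.triv x) fun h2 => h ⟨h1, h2.symm⟩, mul_zero]
  · rw [of_mul_of_ne (QPath.triv y) p h1, zero_mul]

/-- A linear subspace containing the trivial paths and stable under left multiplication by arrows
is the whole path algebra. -/
theorem mem_of_arrow_mul_mem (S : Submodule k (PathAlgebra k V))
    (hv : ∀ x, of (QPath.triv x) ∈ S)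
    (ha : ∀ {x y : V} (a : x ⟶ y), ∀ u ∈ S, arrow a * u ∈ S) (u : PathAlgebra k V) : u ∈ S := by
  induction u using PathAlgebra.induction with
  | zero => exact S.zero_mem
  | add u v hu hv => exact S.add_mem hu hv
  | smul_of c p =>
    refine S.smul_mem c ?_
    obtain ⟨x, y, p⟩ := p
    induction p with
    | nil => exact hv x
    | cons p a ih =>
      rw [of_cons]
      exact ha a _ ih

/-- Two algebra morphisms out of a path algebra agree if they agree on vertices and arrows. -/
theorem algHom_ext {R : Type*} [Ring R] [Algebra k R] {φ ψ : PathAlgebra k V →ₐ[k] R}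
    (hv : ∀ x, φ (of (QPath.triv x)) = ψ (of (QPath.triv x)))
    (ha : ∀ {x y : V} (a : x ⟶ y), φ (arrow a) = ψ (arrow a)) : φ = ψ := by
  refine AlgHom.ext fun u => mem_of_arrow_mul_mem
    (LinearMap.eqLocus φ.toLinearMap ψ.toLinearMap) hv (fun a u hu => ?_) u
  change φ _ = ψ _
  rw [map_mul, map_mul, ha]
  exact congrArg _ hu

end PathAlgebra

theorem PathFamily.lift_vertex {k : Type*} [CommRing k] {V : Type*} [Quiver V] [Fintype V]
    {R : Type*} [Ring R] [Algebra k R] (Φ : PathFamily V R) (x : V) :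
    Φ.lift (PathAlgebra.of (k := k) (QPath.triv x)) = Φ.vert x := Φ.lift_of _

theorem PathFamily.lift_arrow {k : Type*} [CommRing k] {V : Type*} [Quiver V] [Fintype V]
    {R : Type*} [Ring R] [Algebra k R] (Φ : PathFamily V R) {x y : V} (a : x ⟶ y) :
    Φ.lift (PathAlgebra.arrow (k := k) a) = Φ.arr a :=
  (Φ.lift_of _).trans (Φ.arr_mul_vert a)

/-! ### Vertices and arrows of a bound quiver algebra -/

namespace QuiverAlgebra

variable {k : Type*} [CommRing k] {V : Type*} [Quiver V] [Fintype V]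
  (I : TwoSidedIdeal (PathAlgebra k V))

/-- The class in `kQ/I` of an arrow. -/
def arrow {x y : V} (a : x ⟶ y) : QuiverAlgebra I :=
  Ideal.Quotient.mk I.asIdeal (PathAlgebra.arrow a)

/-- The class in `kQ/I` of a path. -/
def path {x y : V} (p : Quiver.Path x y) : QuiverAlgebra I :=
  Ideal.Quotient.mk I.asIdeal (PathAlgebra.of ⟨x, y, p⟩)

theorem path_cons {x y z : V} (p : Quiver.Path x y) (a : y ⟶ z) :
    path I (p.cons a) = arrow I a * path I p := by
  rw [path, PathAlgebra.of_cons, map_mul]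
  rfl

theorem vertex_mul_self (x : V) : vertex I x * vertex I x = vertex I x := by
  rw [vertex, ← map_mul, PathAlgebra.vertex_mul_self]

theorem vertex_mul_of_ne (x y : V) (h : x ≠ y) : vertex I x * vertex I y = 0 := by
  rw [vertex, vertex, ← map_mul, PathAlgebra.vertex_mul_of_ne x y h, map_zero]

theorem sum_vertex : ∑ x, vertex I x = 1 := by
  simp only [vertex]
  rw [← map_sum, ← PathAlgebra.one_def, map_one]

theorem vertex_mul_arrow {x y : V} (a : x ⟶ y) : vertex I y * arrow I a = arrow I a := by
  rw [vertex, arrow, ← map_mul, PathAlgebra.vertex_mul_arrow]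

theorem arrow_mul_vertex {x y : V} (a : x ⟶ y) : arrow I a * vertex I x = arrow I a := by
  rw [vertex, arrow, ← map_mul, PathAlgebra.arrow_mul_vertex]

/-- The corner `y B x` consists of the elements `b` with `e_y b e_x = b`. -/
theorem mem_corner_iff {x y : V} {b : QuiverAlgebra I} :
    b ∈ corner I y x ↔ vertex I y * b * vertex I x = b := by
  constructor
  · rintro ⟨c, rfl⟩
    simp only [LinearMap.mulLeftRight_apply]
    rw [← mul_assoc, ← mul_assoc, vertex_mul_self, mul_assoc, vertex_mul_self]
  · intro h
    exact ⟨b, by simpa only [LinearMap.mulLeftRight_apply] using h⟩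

theorem vertex_mem_corner (x : V) : vertex I x ∈ corner I x x := by
  rw [mem_corner_iff, vertex_mul_self, vertex_mul_self]

theorem arrow_mul_mem_corner {x y z : V} (a : y ⟶ z) {b : QuiverAlgebra I}
    (hb : b ∈ corner I y x) : arrow I a * b ∈ corner I z x := by
  rw [mem_corner_iff] at hb ⊢
  have h : b * vertex I x = b := by
    conv_lhs => rw [← hb]
    rw [mul_assoc, vertex_mul_self, hb]
  rw [← mul_assoc, vertex_mul_arrow, mul_assoc, h]

theorem corner_ne_bot {x y : V} {b : QuiverAlgebra I} (hb : b ∈ corner I y x) (h : b ≠ 0) :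
    corner I y x ≠ ⊥ :=
  fun h' => h ((Submodule.mem_bot k).1 (h' ▸ hb))

/-- A linear subspace containing the vertices and stable under left multiplication by arrows
is the whole algebra. -/
theorem mem_of_arrow_mul_mem (S : Submodule k (QuiverAlgebra I)) (hv : ∀ x, vertex I x ∈ S)
    (ha : ∀ {x y : V} (a : x ⟶ y), ∀ u ∈ S, arrow I a * u ∈ S) (u : QuiverAlgebra I) :
    u ∈ S := by
  obtain ⟨u, rfl⟩ := Ideal.Quotient.mk_surjective u
  refine PathAlgebra.mem_of_arrow_mul_mem
    (S.comap (Ideal.Quotient.mkₐ k I.asIdeal).toLinearMap) hv (fun a u hu => ?_) u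
  change Ideal.Quotient.mk I.asIdeal (_ * u) ∈ S
  rw [map_mul]
  exact ha a _ hu

end QuiverAlgebra

/-! ### The retraction and the homotopy for an extension by new arrows -/

namespace AddArrows

open QuiverAlgebra

variable {k : Type*} [CommRing k] {V F : Type*} [Quiver V] (s t : F → V)

/-- A new arrow, as an arrow of `Q_F`. -/
def newHom (f : F) : @Quiver.Hom (AddArrows s t) _ (s f) (t f) := Sum.inr ⟨f, rfl, rfl⟩

/-- An arrow of `Q`, as an arrow of `Q_F`. -/
def oldHom {x y : V} (a : x ⟶ y) : @Quiver.Hom (AddArrows s t) _ x y := Sum.inl a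

variable [Fintype V] (I : TwoSidedIdeal (PathAlgebra k V))

/-- The class of a new arrow in `B_F`. -/
def newArrow (f : F) : QuiverAlgebra (extend s t I) := arrow (extend s t I) (newHom s t f)

theorem algHom_vertex (x : V) :
    algHom s t I (vertex I x) = vertex (V := AddArrows s t) (extend s t I) x := by
  change Ideal.Quotient.mk _ (inclAlg s t (PathAlgebra.of (QPath.triv x))) = _
  rw [inclAlg_of]
  rfl

theorem algHom_arrow {x y : V} (a : x ⟶ y) :
    algHom s t I (arrow I a) = arrow (extend s t I) (oldHom s t a) := by
  change Ideal.Quotient.mk _ (inclAlg s t (PathAlgebra.of ⟨x, y, a.toPath⟩)) = _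
  rw [inclAlg_of]
  rfl

theorem vertex_mul_newArrow (f : F) :
    algHom s t I (vertex I (t f)) * newArrow s t I f = newArrow s t I f := by
  rw [algHom_vertex]
  exact vertex_mul_arrow _ (newHom s t f)

theorem newArrow_mul_vertex (f : F) :
    newArrow s t I f * algHom s t I (vertex I (s f)) = newArrow s t I f := by
  rw [algHom_vertex]
  exact arrow_mul_vertex _ (newHom s t f)

/-- A linear subspace of `B_F` containing the vertices and stable under left multiplication by the
old and the new arrows is the whole algebra. -/
theorem mem_of_mul_mem (S : Submodule k (QuiverAlgebra (extend s t I)))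
    (hv : ∀ x, algHom s t I (vertex I x) ∈ S)
    (ha : ∀ {x y : V} (a : x ⟶ y), ∀ u ∈ S, algHom s t I (arrow I a) * u ∈ S)
    (hf : ∀ f, ∀ u ∈ S, newArrow s t I f * u ∈ S) (u : QuiverAlgebra (extend s t I)) :
    u ∈ S := by
  refine mem_of_arrow_mul_mem _ S (fun x => algHom_vertex s t I x ▸ hv x) (fun {x y} a u hu => ?_) u
  rcases a with a | ⟨f, hs, ht⟩
  · have ha' : algHom s t I (arrow I a) = arrow (extend s t I) (Sum.inl a) :=
      algHom_arrow s t I a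
    exact ha' ▸ ha a u hu
  · subst hs ht
    exact hf f u hu

section Lift

variable {R : Type*} [Ring R] [Algebra k R]

/-- The family of generators in `R` given by an algebra morphism `φ : B → R` on `Q` and by elements
of `R` for the new arrows. -/
def family (φ : QuiverAlgebra I →ₐ[k] R) (r : F → R)
    (hl : ∀ f, φ (vertex I (t f)) * r f = r f) (hr : ∀ f, r f * φ (vertex I (s f)) = r f) :
    PathFamily (AddArrows s t) R where
  vert x := φ (vertex I (show V from x))
  arr a := Sum.elim (fun a => φ (arrow I a)) (fun f => r f.1) a
  vert_mul_self x := by rw [← map_mul, vertex_mul_self]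
  vert_mul_of_ne x y h := by rw [← map_mul, vertex_mul_of_ne I _ _ h, map_zero]
  sum_vert := by
    have h := congrArg φ (sum_vertex I)
    rw [map_sum, map_one] at h
    exact h
  vert_mul_arr a := by
    rcases a with a | ⟨f, rfl, rfl⟩
    · exact (map_mul φ _ _).symm.trans (congrArg φ (vertex_mul_arrow I a))
    · exact hl f
  arr_mul_vert a := by
    rcases a with a | ⟨f, rfl, rfl⟩
    · exact (map_mul φ _ _).symm.trans (congrArg φ (arrow_mul_vertex I a))
    · exact hr f

/-- The universal property of `B_F`: an algebra morphism `φ : B → R` and elements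
`r f ∈ φ(e_{t(f)}) R φ(e_{s(f)})` extend to an algebra morphism `B_F → R`. -/
theorem exists_lift (φ : QuiverAlgebra I →ₐ[k] R) (r : F → R)
    (hl : ∀ f, φ (vertex I (t f)) * r f = r f) (hr : ∀ f, r f * φ (vertex I (s f)) = r f) :
    ∃ Φ : QuiverAlgebra (extend s t I) →ₐ[k] R,
      Φ.comp (algHom s t I) = φ ∧ ∀ f, Φ (newArrow s t I f) = r f := by
  set Ψ : PathAlgebra k (AddArrows s t) →ₐ[k] R := (family s t I φ r hl hr).lift with hΨ
  have hΨι : Ψ.comp (inclAlg s t) = φ.comp (Ideal.Quotient.mkₐ k I.asIdeal) := by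
    refine PathAlgebra.algHom_ext (fun x => ?_) (fun {x y} a => ?_)
    · change Ψ (inclAlg s t _) = _
      rw [inclAlg_of]
      exact (family s t I φ r hl hr).lift_vertex (show AddArrows s t from x)
    · change Ψ (inclAlg s t (PathAlgebra.of _)) = _
      rw [inclAlg_of]
      exact (family s t I φ r hl hr).lift_arrow (oldHom s t a)
  have hker : extend s t I ≤ TwoSidedIdeal.ker Ψ := by
    refine TwoSidedIdeal.span_le.2 ?_
    rintro _ ⟨x, hx, rfl⟩
    rw [SetLike.mem_coe, TwoSidedIdeal.mem_ker]
    refine (DFunLike.congr_fun hΨι x).trans ?_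
    change φ (Ideal.Quotient.mk I.asIdeal x) = 0
    rw [Ideal.Quotient.eq_zero_iff_mem.2 (TwoSidedIdeal.mem_asIdeal.2 hx), map_zero]
  refine ⟨Ideal.Quotient.liftₐ (extend s t I).asIdeal Ψ
    fun x hx => (TwoSidedIdeal.mem_ker Ψ).1 (hker (TwoSidedIdeal.mem_asIdeal.1 hx)), ?_, ?_⟩
  · refine AlgHom.ext fun x => ?_
    obtain ⟨x, rfl⟩ := Ideal.Quotient.mk_surjective x
    exact DFunLike.congr_fun hΨι x
  · exact fun f => (family s t I φ r hl hr).lift_arrow (newHom s t f)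

end Lift

/-- The retraction `B_F → B` of the canonical morphism, which sends the new arrows to `0`. -/
theorem exists_retraction : ∃ π : QuiverAlgebra (extend s t I) →ₐ[k] QuiverAlgebra I,
    π.comp (algHom s t I) = AlgHom.id k _ ∧ ∀ f, π (newArrow s t I f) = 0 :=
  exists_lift s t I (AlgHom.id k _) 0 (by simp) (by simp)

open Hochschild in
/-- The linear map `h : B_F → B_F ⊗ B_F` that splits a path at its last new arrow `f`,
`h(b f a) = f a ⊗ b` for a path `b` of `Q`, and kills the paths of `Q`. It is the derivation with
`h(f) = f ⊗ e_{t(f)}` and `h(B) = 0` with values in the bimodule `B_F ⊗ B_F` where `a` acts on the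
right by `x ⊗ y ↦ x a ⊗ y` and `b ∈ B` on the left by `x ⊗ y ↦ x ⊗ b y`; this is what makes it
compatible with the relations. -/
theorem exists_homotopy :
    ∃ h : QuiverAlgebra (extend s t I) →ₗ[k]
        QuiverAlgebra (extend s t I) ⊗[k] QuiverAlgebra (extend s t I),
      ∀ b f a, h (algHom s t I b * (newArrow s t I f * a)) =
        (newArrow s t I f * a) ⊗ₜ algHom s t I (b * vertex I (t f)) := by
  obtain ⟨Φ, hΦ, hΦf⟩ := exists_lift s t I (splitRep (algHom s t I))
    (fun f => splitEnd (newArrow s t I f) (algHom s t I (vertex I (t f))))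
    (fun f => by
      refine LinearMap.ext fun ⟨y, m⟩ => ?_
      rw [Module.End.mul_apply, splitEnd_apply, splitRep_apply, ← mul_assoc, vertex_mul_newArrow,
        LinearMap.lTensor_tmul, LinearMap.mulLeft_apply, ← map_mul, vertex_mul_self])
    (fun f => by
      refine LinearMap.ext fun ⟨y, m⟩ => ?_
      rw [Module.End.mul_apply, splitRep_apply, splitEnd_apply, splitEnd_apply, ← mul_assoc,
        newArrow_mul_vertex])
  have hΦι : ∀ b, Φ (algHom s t I b) = splitRep (algHom s t I) b :=
    fun b => DFunLike.congr_fun hΦ b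
  have hι : ∀ b, algHom s t I b ∈ fstMulLocus Φ := fun b y m => by rw [hΦι, splitRep_apply]
  have hf : ∀ f, newArrow s t I f ∈ fstMulLocus Φ := fun f y m => by rw [hΦf, splitEnd_apply]
  obtain ⟨h, hh⟩ := exists_linearMap_of_splitRep (algHom s t I) Φ (newArrow s t I)
    (fun f => algHom s t I (vertex I (t f))) hΦι hΦf
    fun x => mem_fstMulLocus.1 (mem_of_mul_mem s t I (fstMulLocus Φ) (fun _ => hι _)
      (fun _ _ hu => mul_mem_fstMulLocus (hι _) hu)
      (fun f _ hu => mul_mem_fstMulLocus (hf f) hu) x)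
  exact ⟨h, fun b f a => by rw [hh, map_mul]⟩

/-! ### Absence of relative cycles -/

variable {s t I}

/-- A path of `Q_F` is zero in `B_F`, or comes from `Q`, or its class is a multiple of an element
of the corner after its last new arrow, and then its new arrows form a relative path. -/
theorem path_cases {x y : AddArrows s t} (p : Quiver.Path x y) :
    path (extend s t I) p = 0 ∨
    (∃ b ∈ corner (V := V) I y x, path (extend s t I) p = algHom s t I b) ∨
    ∃ (f : F) (γ : List F), IsRelativePath s t I (f :: γ) ∧
      corner (V := V) I (s ((f :: γ).getLast (List.cons_ne_nil _ _))) x ≠ ⊥ ∧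
      ∃ b ∈ corner (V := V) I y (t f), ∃ q, path (extend s t I) p = algHom s t I b * q := by
  induction p with
  | nil =>
    refine .inr (.inl ⟨vertex (V := V) I x, vertex_mem_corner _ _, ?_⟩)
    exact (algHom_vertex s t I x).symm
  | cons p a ih =>
    rw [path_cons]
    rcases a with a | ⟨f, hs, ht⟩
    · have ha : arrow (extend s t I) (Sum.inl a) = algHom s t I (arrow I a) :=
        (algHom_arrow s t I a).symm
      rcases ih with h | ⟨b, hb, h⟩ | ⟨f, γ, hγ, hx, b, hb, q, h⟩
      · exact .inl (by rw [h, mul_zero])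
      · refine .inr (.inl ⟨arrow I a * b, arrow_mul_mem_corner I a hb, ?_⟩)
        rw [h, map_mul]
        exact congrArg (· * _) ha
      · refine .inr (.inr ⟨f, γ, hγ, hx, arrow I a * b, arrow_mul_mem_corner I a hb, q, ?_⟩)
        rw [h, map_mul, mul_assoc]
        exact congrArg (· * _) ha
    · subst hs ht
      have hf : arrow (extend s t I) (Sum.inr ⟨f, rfl, rfl⟩) * path (extend s t I) p =
          algHom s t I (vertex I (t f)) * (newArrow s t I f * path (extend s t I) p) := by
        rw [← mul_assoc, vertex_mul_newArrow]
        rfl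
      rcases ih with h | ⟨b, hb, h⟩ | ⟨g, γ, hγ, hx, b, hb, q, h⟩
      · exact .inl (by rw [h, mul_zero])
      · by_cases hb0 : b = 0
        · exact .inl (by rw [h, hb0, map_zero, mul_zero])
        · exact .inr (.inr ⟨f, [], ⟨List.cons_ne_nil _ _, List.isChain_singleton _⟩,
            corner_ne_bot I hb hb0, _, vertex_mem_corner I _, _, hf⟩)
      · by_cases hb0 : b = 0
        · exact .inl (by rw [h, hb0, map_zero, zero_mul, mul_zero])
        · exact .inr (.inr ⟨f, g :: γ, ⟨List.cons_ne_nil _ _,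
            List.isChain_cons_cons.2 ⟨corner_ne_bot I hb hb0, hγ.chain⟩⟩, hx, _,
            vertex_mem_corner I _, _, hf⟩)

/-- Without relative cycles, a path of `Q_F` that is parallel to the reverse of a new arrow is zero
in `B_F`. -/
theorem path_eq_zero (hF : ∀ γ : List F, ¬ IsRelativeCycle s t I γ) (f : F)
    (p : @Quiver.Path (AddArrows s t) _ (t f) (s f)) : path (extend s t I) p = 0 := by
  rcases path_cases (I := I) p with h | ⟨b, hb, h⟩ | ⟨g, γ, hγ, hx, b, hb, q, h⟩
  · exact h
  · by_contra hp
    have hb0 : b ≠ 0 := fun hb0 => hp (by rw [h, hb0, map_zero])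
    exact hF [f] ⟨⟨List.cons_ne_nil _ _, List.isChain_singleton _⟩, corner_ne_bot I hb hb0⟩
  · by_contra hp
    have hb0 : b ≠ 0 := fun hb0 => hp (by rw [h, hb0, map_zero, zero_mul])
    exact hF (f :: g :: γ) ⟨⟨List.cons_ne_nil _ _,
      List.isChain_cons_cons.2 ⟨corner_ne_bot I hb hb0, hγ.chain⟩⟩, hx⟩

/-- Without relative cycles, `e_{s(f)} B_F e_{t(f)} = 0` for each new arrow `f`. -/
theorem vertex_mul_mul_vertex_eq_zero (hF : ∀ γ : List F, ¬ IsRelativeCycle s t I γ) (f : F)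
    (c : QuiverAlgebra (extend s t I)) :
    algHom s t I (vertex I (s f)) * c * algHom s t I (vertex I (t f)) = 0 := by
  obtain ⟨c, rfl⟩ := Ideal.Quotient.mk_surjective c
  rw [algHom_vertex, algHom_vertex]
  change Ideal.Quotient.mk (extend s t I).asIdeal
    (PathAlgebra.of (k := k) (V := AddArrows s t) (QPath.triv (s f)) * c *
      PathAlgebra.of (k := k) (V := AddArrows s t) (QPath.triv (t f))) = 0
  induction c using PathAlgebra.induction with
  | zero => simp
  | add c c' hc hc' => rw [mul_add, add_mul, map_add, hc, hc', add_zero]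
  | smul_of r p =>
    rw [mul_smul_comm, smul_mul_assoc]
    suffices h : Ideal.Quotient.mk (extend s t I).asIdeal
        (PathAlgebra.of (k := k) (V := AddArrows s t) (QPath.triv (s f)) *
          PathAlgebra.of p * PathAlgebra.of (k := k) (V := AddArrows s t) (QPath.triv (t f))) = 0 by
      rw [Ideal.Quotient.eq_zero_iff_mem] at h ⊢
      exact Submodule.smul_of_tower_mem _ r h
    by_cases hp : p.tgt = s f ∧ p.src = t f
    · obtain ⟨x, y, p⟩ := p
      obtain ⟨rfl, rfl⟩ := hp
      rw [map_mul, map_mul]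
      change _ * path (extend s t I) p * _ = 0
      rw [path_eq_zero hF f p, mul_zero, zero_mul]
    · rw [PathAlgebra.vertex_mul_mul_vertex_of_ne p _ _ hp, map_zero]

variable (s t I)

open Hochschild in
/-- Modulo boundaries, `B_F ⊗ B_F` reduces to `B_F ⊗ B`: the second factor can be cut into arrows,
and `c ⊗ f` with `f` a new arrow reduces to `e_{s(f)} c e_{t(f)} ⊗ f = 0`. -/
theorem mem_range_d₂_sup (hF : ∀ γ : List F, ¬ IsRelativeCycle s t I γ)
    (z : QuiverAlgebra (extend s t I) ⊗[k] QuiverAlgebra (extend s t I)) :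
    z ∈ LinearMap.range (d₂ k (QuiverAlgebra (extend s t I))) ⊔
      LinearMap.range (LinearMap.lTensor (QuiverAlgebra (extend s t I))
        (algHom s t I).toLinearMap) := by
  set A := QuiverAlgebra (extend s t I) with hA
  set ι := algHom s t I with hι
  set L := LinearMap.range (d₂ k A) ⊔ LinearMap.range (LinearMap.lTensor A ι.toLinearMap) with hL
  have hold : ∀ a b, a ⊗ₜ ι b ∈ L := fun a b =>
    Submodule.mem_sup_right ⟨a ⊗ₜ b, by simp⟩
  have hmul : ∀ a b c : A, (a * b) ⊗ₜ c ∈ L → (c * a) ⊗ₜ b ∈ L → a ⊗ₜ (b * c) ∈ L := by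
    intro a b c h₁ h₂
    have h₃ : d₂ k A (a ⊗ₜ (b ⊗ₜ c)) ∈ L :=
      Submodule.mem_sup_left (LinearMap.mem_range_self _ _)
    rw [d₂_tmul] at h₃
    convert sub_mem (add_mem h₁ h₂) h₃ using 1
    abel
  have hnew : ∀ f a, a ⊗ₜ newArrow s t I f ∈ L := by
    intro f a
    rw [← vertex_mul_newArrow]
    refine hmul _ _ _ ?_ (hold _ _)
    rw [← newArrow_mul_vertex]
    refine hmul _ _ _ (hold _ _) ?_
    rw [← mul_assoc, vertex_mul_mul_vertex_eq_zero hF, TensorProduct.zero_tmul]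
    exact L.zero_mem
  induction z with
  | zero => exact L.zero_mem
  | add x y hx hy => exact L.add_mem hx hy
  | tmul a x =>
    let S : Submodule k A :=
      { carrier := {x | ∀ a, a ⊗ₜ x ∈ L}
        add_mem' := fun hx hy a => by
          rw [TensorProduct.tmul_add]
          exact L.add_mem (hx a) (hy a)
        zero_mem' := fun a => by simp
        smul_mem' := fun c x hx a => by
          rw [TensorProduct.tmul_smul]
          exact L.smul_mem c (hx a) }
    exact mem_of_mul_mem s t I S (fun _ _ => hold _ _)
      (fun _ u hu _ => hmul _ _ _ (hu _) (hold _ _))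
      (fun f u hu _ => hmul _ _ _ (hu _) (hnew f _)) x a

/-- `B_F` is the sum of `B` and of the span of the products `b f a` with `b ∈ B`, `f` a new arrow
and `a ∈ B_F`; the latter is the kernel of the retraction `π`. -/
theorem sub_algHom_mem_span (π : QuiverAlgebra (extend s t I) →ₐ[k] QuiverAlgebra I)
    (hπ : π.comp (algHom s t I) = AlgHom.id k _) (hπf : ∀ f, π (newArrow s t I f) = 0)
    (a : QuiverAlgebra (extend s t I)) :
    a - algHom s t I (π a) ∈ Submodule.span k
      ((fun p : QuiverAlgebra I × QuiverAlgebra (extend s t I) => algHom s t I p.1 * p.2) ''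
        {p | ∃ b f c, p = (b * vertex I (t f), newArrow s t I f * c)}) := by
  set N : Set (QuiverAlgebra I × QuiverAlgebra (extend s t I)) :=
    {p | ∃ b f c, p = (b * vertex I (t f), newArrow s t I f * c)}
  set W := Submodule.span k
    ((fun p : QuiverAlgebra I × QuiverAlgebra (extend s t I) => algHom s t I p.1 * p.2) '' N)
  have hπ' : ∀ b, π (algHom s t I b) = b := fun b => DFunLike.congr_fun hπ b
  have hmul : ∀ b, ∀ w ∈ W, algHom s t I b * w ∈ W := by
    intro b w hw
    induction hw using Submodule.span_induction with
    | mem x hx =>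
      obtain ⟨_, ⟨b', f, c, rfl⟩, rfl⟩ := hx
      refine Submodule.subset_span ⟨_, ⟨b * b', f, c, rfl⟩, ?_⟩
      simp only [map_mul, mul_assoc]
    | zero => rw [mul_zero]; exact W.zero_mem
    | add x y _ _ hx hy => rw [mul_add]; exact W.add_mem hx hy
    | smul r x _ hx => rw [mul_smul_comm]; exact W.smul_mem r hx
  let S := W.comap (LinearMap.id - (algHom s t I).toLinearMap ∘ₗ π.toLinearMap)
  have hS : ∀ x, x ∈ S ↔ x - algHom s t I (π x) ∈ W := fun _ => Iff.rfl
  refine (hS a).1 (mem_of_mul_mem s t I S (fun x => ?_) (fun a u hu => ?_) (fun f u _ => ?_) a)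
  · rw [hS, hπ', sub_self]
    exact W.zero_mem
  · rw [hS] at hu ⊢
    rw [map_mul, hπ', map_mul, ← mul_sub]
    exact hmul _ _ hu
  · rw [hS, map_mul, hπf, zero_mul, map_zero, sub_zero]
    refine Submodule.subset_span ⟨_, ⟨1, f, u, rfl⟩, ?_⟩
    simp only [one_mul]
    rw [← mul_assoc, vertex_mul_newArrow]

end AddArrows

end

theorem theorem5p4 {k : Type*} [Field k]
    {V : Type*} [Fintype V] [Quiver V] [∀ x y : V, Finite (x ⟶ y)]
    (I : TwoSidedIdeal (PathAlgebra k V)) (hI : PathAlgebra.IsAdmissible I)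
    {F : Type*} [Finite F] (s t : F → V)
    (hF : ∀ γ : List F, ¬ AddArrows.IsRelativeCycle s t I γ) :
    Function.Bijective (Hochschild.HH₁.map (AddArrows.algHom s t I)) := by
  obtain ⟨π, hπ, hπf⟩ := AddArrows.exists_retraction s t I
  obtain ⟨h, hh⟩ := AddArrows.exists_homotopy s t I
  refine Hochschild.HH₁.map_bijective_of_homotopy _ π hπ
    {p | ∃ b f c, p = (b * QuiverAlgebra.vertex I (t f), AddArrows.newArrow s t I f * c)} h ?_ ?_
    (AddArrows.sub_algHom_mem_span s t I π hπ hπf) (AddArrows.mem_range_d₂_sup s t I hF)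
  · rintro _ ⟨b, f, c, rfl⟩ d
    rw [← mul_assoc, ← map_mul, hh, ← mul_assoc, mul_assoc (d * b),
      QuiverAlgebra.vertex_mul_self]
  · rintro _ ⟨b, f, c, rfl⟩ d
    rw [mul_assoc, mul_assoc, hh, mul_assoc b, QuiverAlgebra.vertex_mul_self]
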